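/- For a word $w=w_1\cdots w_n$ over the ordered alphabet $[d]=\{1<\dots<d\}$ let $\lambda=(\lambda_1\ge\dots\ge\lambda_d)$, $\lambda_i\in\mathbb{N}$, be its RSK shape, i.e. the sequence of row lengths (padded by zeros) of the tableau obtained by inserting $w_1,\dots,w_n$ successively by Schensted row insertion (an inserted letter bumps the leftmost strictly larger entry of the row into the next row, or is appended to the row if there is no such entry). For a probability distribution $\alpha=(\alpha_1,\dots,\alpha_d)$ on $[d]$ let $\mathrm{SW}_n(\alpha)$ be the law of the RSK shape of a random word whose $n$ letters are drawn independently from $\alpha$. Let $\alpha$ be sorted, $\alpha_1\ge\alpha_2\ge\dots\ge\alpha_d$, let $k\in[d]$, and let $\nu_k=\min\{1,\alpha_k d\}$. Then for every $n\in\mathbb{N}$ $$\alpha_k n-2\sqrt{\nu_k n}\;\le\;\mathop{\mathbf E}_{\lambda\sim \mathrm{SW}_n(\alpha)}[\lambda_k]\;\le\;\alpha_k n+2\sqrt{\nu_k n},$$ and, more precisely, $$\alpha_k n-2\sqrt{\alpha_k k\, n}\;\le\;\mathop{\mathbf E}_{\lambda\sim \mathrm{SW}_n(\alpha)}[\lambda_k]\;\le\;\alpha_k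 n+2\sqrt{(\alpha_k+\alpha_{k+1}+\dots+\alpha_d)\,n}.$$ Moreover, for every $n\in\mathbb{N}$, the expected length of the longest increasing subsequence of a uniformly random permutation of $\{1,\dots,n\}$ is at most $2\sqrt n$. -/

import Mathlib

open MeasureTheory

namespace RSK

/-- Row insertion of the letter `x` into a (weakly increasing) row: `x` replaces the leftmost entry
that is strictly larger than `x`, and that entry is bumped; if there is none, `x` is appended at
the end of the row and nothing is bumped. Returns the new row and the bumped entry, if any. -/
def rowInsert {β : Type*} [LinearOrder β] (x : β) : List β → List β × Option β
  | [] => ([x], none)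
  | y :: r =>
      if x < y then (x :: r, some y)
      else (y :: (rowInsert x r).1, (rowInsert x r).2)

/-- Schensted insertion of `x` into a tableau, given by the list of its rows (top row first):
insert `x` into the first row, the bumped entry into the second row, and so on. -/
def insert {β : Type*} [LinearOrder β] : List (List β) → β → List (List β)
  | [], x => [[x]]
  | r :: T, x =>
      match (rowInsert x r).2 with
      | none => (rowInsert x r).1 :: T
      | some y => (rowInsert x r).1 :: insert T y

/-- The insertion tableau `P` of the word `w₁ ⋯ wₙ`. -/
def tableau {β : Type*} [LinearOrder β] {n : ℕ} (w : Fin n → β) : List (List β) :=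
  (List.ofFn w).foldl insert []

/-- The RSK shape `(λ₁, …, λ_d)` of a word over a `d`-letter alphabet: `λ_k` is the length of the
`k`-th row of the insertion tableau, and is `0` if there is no such row. -/
def shape {n d : ℕ} (w : Fin n → Fin d) : Fin d → ℕ :=
  fun k => ((tableau w).getD k []).length

end RSK

/-- The law of a random letter of the alphabet with probabilities `α`. -/
noncomputable def letterLaw {d : ℕ} (α : Fin d → ℝ) : Measure (Fin d) :=
  ∑ i, ENNReal.ofReal (α i) • Measure.dirac i

/-- The law of the `n`-letter `α`-random word: the letters are independent with law `α`. -/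
noncomputable def wordLaw (n : ℕ) {d : ℕ} (α : Fin d → ℝ) : Measure (Fin n → Fin d) :=
  Measure.pi fun _ => letterLaw α

/-- The Schur–Weyl distribution: the law of the RSK shape of the `n`-letter `α`-random word. -/
noncomputable def schurWeyl (n : ℕ) {d : ℕ} (α : Fin d → ℝ) : Measure (Fin d → ℕ) :=
  (wordLaw n α).map RSK.shape

open Classical in
/-- The length of the longest (weakly) increasing subsequence of `w₁, …, wₙ`; a subsequence is
given by the set of its positions. -/
noncomputable def lis {β : Type*} [LinearOrder β] {n : ℕ} (w : Fin n → β) : ℕ :=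
  (Finset.univ.filter fun s : Finset (Fin n) => MonotoneOn w (s : Set (Fin n))).sup Finset.card

/-- The expected length of the longest increasing subsequence of a uniformly random permutation. -/
noncomputable def expectedLisPerm (n : ℕ) : ℝ :=
  (∑ π : Equiv.Perm (Fin n), (lis π : ℝ)) / (Nat.factorial n : ℝ)

/-!
The `k`-th row of the tableau is a weakly increasing subsequence, without letters below `k`, of the
reading word, which is Knuth equivalent to `w`; as the longest such subsequence is a Knuth
invariant, it bounds `λ_k` from above. The number of customers that leave queues in series with
entrance `k`, driven by the letters of `w`, is a Knuth invariant too, and bounds `λ_k` from below.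

Both quantities are evolved from a random initial state instead of the empty one: a row with
independent geometric letter counts, and queues with independent geometric lengths. These laws are
stationary, so that each letter of `w` increases the mean of the two quantities by at most
`α_k + δ` and by at least `α_k - δ`, where `δ` is a free parameter of the geometric laws. The
initial state contributes at most `(α_k + ⋯ + α_d) / δ` and `(k - 1) α_k / δ` (letters from `1`),
and the optimal `δ` gives the two bounds. Permutations are the case of uniform words over a growing
alphabet, where `α_1 → 0`.
-/

namespace RSK

open scoped ENNReal

/-- Knuth (plactic) equivalence of words. -/
inductive Knuth {β : Type*} [LinearOrder β] : List β → List β → Prop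
  | refl (u : List β) : Knuth u u
  | symm {u v : List β} : Knuth u v → Knuth v u
  | trans {u v w : List β} : Knuth u v → Knuth v w → Knuth u w
  | cons (a : β) {u v : List β} : Knuth u v → Knuth (a :: u) (a :: v)
  | append_right (t : List β) {u v : List β} : Knuth u v → Knuth (u ++ t) (v ++ t)
  | swap_before {x y z : β} : x ≤ y → y < z → Knuth [x, z, y] [z, x, y]
  | swap_after {x y z : β} : x < y → y ≤ z → Knuth [y, z, x] [y, x, z]

/-- The row reading word of a tableau, from the last row to the first one. -/
def reading {β : Type*} (T : List (List β)) : List β := T.reverse.flatten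

/-- The rows of `T`, numbered from `i` on, are weakly increasing, and the letters of each of them
are at least its number. -/
def RowsFrom {d : ℕ} : ℕ → List (List (Fin d)) → Prop
  | _, [] => True
  | i, r :: T => r.Pairwise (· ≤ ·) ∧ (∀ a ∈ r, i ≤ a.val) ∧ RowsFrom (i + 1) T

theorem reading_cons {β : Type*} (r : List β) (T : List (List β)) :
    reading (r :: T) = reading T ++ r := by
  simp [reading]

theorem getD_sublist_reading {β : Type*} (T : List (List β)) (j : ℕ) :
    (T.getD j []).Sublist (reading T) := by
  rcases lt_or_ge j T.length with hj | hj
  · rw [List.getD_eq_getElem _ _ hj]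
    exact List.sublist_flatten_of_mem (List.mem_reverse.mpr (List.getElem_mem hj))
  · rw [List.getD_eq_default _ _ hj]
    exact List.nil_sublist _

section Knuth

variable {β : Type*} [LinearOrder β] {x y b : β} {r : List β}

theorem Knuth.append_left (t : List β) {u v : List β} (h : Knuth u v) :
    Knuth (t ++ u) (t ++ v) := by
  induction t with
  | nil => exact h
  | cons a t ih => exact ih.cons a

theorem Knuth.foldl_eq {S : Type*} {act : S → β → S} {Inv : S → Prop}
    (hInv : ∀ s a, Inv s → Inv (act s a))
    (hbefore : ∀ s x y z, Inv s → x ≤ y → y < z →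
      act (act (act s x) z) y = act (act (act s z) x) y)
    (hafter : ∀ s x y z, Inv s → x < y → y ≤ z →
      act (act (act s y) z) x = act (act (act s y) x) z)
    {u v : List β} (h : Knuth u v) : ∀ s, Inv s → u.foldl act s = v.foldl act s := by
  induction h with
  | refl u => exact fun _ _ => rfl
  | symm _ ih => exact fun s hs => (ih s hs).symm
  | trans _ _ ih₁ ih₂ => exact fun s hs => (ih₁ s hs).trans (ih₂ s hs)
  | cons a _ ih => exact fun s hs => ih _ (hInv s a hs)
  | append_right t _ ih => intro s hs; rw [List.foldl_append, List.foldl_append, ih s hs]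
  | swap_before h₁ h₂ => exact fun s hs => hbefore s _ _ _ hs h₁ h₂
  | swap_after h₁ h₂ => exact fun s hs => hafter s _ _ _ hs h₁ h₂

theorem mem_rowInsert {c : β} (h : c ∈ (rowInsert x r).1) : c = x ∨ c ∈ r := by
  induction r with
  | nil => simpa [rowInsert] using h
  | cons y r ih =>
    unfold rowInsert at h
    split_ifs at h with hxy <;> simp only [List.mem_cons] at h ⊢ <;> tauto

theorem self_mem_rowInsert (x : β) (r : List β) : x ∈ (rowInsert x r).1 := by
  induction r with
  | nil => simp [rowInsert]
  | cons y r ih => unfold rowInsert; split_ifs <;> simp [ih]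

theorem pairwise_rowInsert (x : β) (h : r.Pairwise (· ≤ ·)) :
    (rowInsert x r).1.Pairwise (· ≤ ·) := by
  induction r with
  | nil => simp [rowInsert]
  | cons y r ih =>
    rw [List.pairwise_cons] at h
    unfold rowInsert
    split_ifs with hxy <;> simp only [List.pairwise_cons]
    · exact ⟨fun a ha => hxy.le.trans (h.1 a ha), h.2⟩
    · refine ⟨fun a ha => ?_, ih h.2⟩
      rcases mem_rowInsert ha with rfl | ha
      · exact not_lt.mp hxy
      · exact h.1 a ha

theorem rowInsert_eq_append (h : (rowInsert x r).2 = none) : (rowInsert x r).1 = r ++ [x] := by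
  induction r with
  | nil => simp [rowInsert]
  | cons y r ih =>
    unfold rowInsert at h ⊢
    split_ifs at h ⊢ with hxy
    simp_all

theorem lt_of_rowInsert_eq_some (h : (rowInsert x r).2 = some b) : x < b := by
  induction r with
  | nil => simp [rowInsert] at h
  | cons y r ih =>
    unfold rowInsert at h
    split_ifs at h with hxy
    · simp_all
    · exact ih h

theorem knuth_cons_append_singleton (h : (y :: r).Pairwise (· ≤ ·)) (hxy : x < y) :
    Knuth (y :: r ++ [x]) (y :: x :: r) := by
  induction r generalizing y with
  | nil => exact .refl _
  | cons z r ih =>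
    obtain ⟨hy, hr⟩ := List.pairwise_cons.mp h
    have hyz : y ≤ z := hy z List.mem_cons_self
    exact ((ih hr (hxy.trans_le hyz)).cons y).trans ((Knuth.swap_after hxy hyz).append_right r)

theorem knuth_cons_cons_of_mem (h : (y :: r).Pairwise (· ≤ ·)) (hx : x ∈ r) (hxb : x < b) :
    Knuth (y :: b :: r) (b :: y :: r) := by
  cases r with
  | nil => simp at hx
  | cons z r =>
    obtain ⟨hy, hr⟩ := List.pairwise_cons.mp h
    have hzx : z ≤ x := by
      rcases List.mem_cons.mp hx with rfl | hx
      exacts [le_rfl, (List.pairwise_cons.mp hr).1 x hx]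
    exact (Knuth.swap_before (hy z List.mem_cons_self) (hzx.trans_lt hxb)).append_right r

theorem knuth_rowInsert (h : r.Pairwise (· ≤ ·)) (hb : (rowInsert x r).2 = some b) :
    Knuth (r ++ [x]) (b :: (rowInsert x r).1) := by
  induction r with
  | nil => simp [rowInsert] at hb
  | cons y r ih =>
    have hsorted := pairwise_rowInsert x h
    unfold rowInsert at hb hsorted ⊢
    split_ifs at hb hsorted ⊢ with hxy
    · obtain rfl : y = b := by simpa using hb
      exact knuth_cons_append_singleton h hxy
    · exact ((ih (List.pairwise_cons.mp h).2 hb).cons y).trans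
        (knuth_cons_cons_of_mem hsorted (self_mem_rowInsert x r) (lt_of_rowInsert_eq_some hb))

theorem knuth_insert {T : List (List β)} (hT : ∀ r ∈ T, r.Pairwise (· ≤ ·)) (x : β) :
    Knuth (reading T ++ [x]) (reading (insert T x)) := by
  induction T generalizing x with
  | nil => exact .refl _
  | cons r T ih =>
    unfold insert
    split
    next h => simpa [reading_cons, rowInsert_eq_append h] using Knuth.refl _
    next y h =>
      have hrow := (knuth_rowInsert (hT r (by simp)) h).append_left (reading T)
      have hrest := (ih (fun r hr => hT r (by simp [hr])) y).append_right (rowInsert x r).1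
      simp only [reading_cons, List.append_assoc, List.singleton_append] at hrow hrest ⊢
      exact hrow.trans hrest

end Knuth

section Tableau

variable {d i : ℕ} {T : List (List (Fin d))}

theorem RowsFrom.pairwise (h : RowsFrom i T) : ∀ r ∈ T, r.Pairwise (· ≤ ·) := by
  induction T generalizing i with
  | nil => simp
  | cons r T ih => exact List.forall_mem_cons.mpr ⟨h.1, ih h.2.2⟩

theorem RowsFrom.pairwise_getD (h : RowsFrom i T) (j : ℕ) :
    (T.getD j []).Pairwise (· ≤ ·) := by
  induction T generalizing i j with
  | nil => simp
  | cons r T ih => cases j with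
    | zero => exact h.1
    | succ j => simpa using ih h.2.2 j

theorem RowsFrom.le_of_mem_getD (h : RowsFrom i T) (j : ℕ) {a : Fin d}
    (ha : a ∈ T.getD j []) : i + j ≤ a := by
  induction T generalizing i j with
  | nil => simp at ha
  | cons r T ih => cases j with
    | zero => exact h.2.1 a ha
    | succ j =>
      have := ih h.2.2 j (by simpa using ha)
      omega

theorem RowsFrom.le_of_mem_reading (h : RowsFrom i T) {a : Fin d} (ha : a ∈ reading T) :
    i ≤ a := by
  induction T generalizing i with
  | nil => simp [reading] at ha
  | cons r T ih =>
    rw [reading_cons] at ha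
    rcases List.mem_append.mp ha with ha | ha
    · exact (Nat.le_succ i).trans (ih h.2.2 ha)
    · exact h.2.1 a ha

theorem RowsFrom.insert (h : RowsFrom i T) {x : Fin d} (hx : i ≤ x) :
    RowsFrom i (RSK.insert T x) := by
  induction T generalizing i x with
  | nil => simp [RSK.insert, RowsFrom, hx]
  | cons r T ih =>
    have hrow : ∀ a ∈ (rowInsert x r).1, i ≤ a.val := fun a ha => by
      rcases mem_rowInsert ha with rfl | ha
      exacts [hx, h.2.1 a ha]
    unfold RSK.insert
    split
    next => exact ⟨pairwise_rowInsert x h.1, hrow, h.2.2⟩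
    next y hy =>
      have hxy : x < y := lt_of_rowInsert_eq_some hy
      exact ⟨pairwise_rowInsert x h.1, hrow, ih h.2.2 (by omega)⟩

theorem RowsFrom.foldl_insert (h : RowsFrom 0 T) (w : List (Fin d)) :
    RowsFrom 0 (w.foldl RSK.insert T) :=
  List.foldlRecOn w RSK.insert h fun _ hT a _ => hT.insert (Nat.zero_le a.val)

theorem RowsFrom.knuth_foldl_insert (h : RowsFrom 0 T) (w : List (Fin d)) :
    Knuth (reading T ++ w) (reading (w.foldl RSK.insert T)) := by
  induction w generalizing T with
  | nil => simpa using Knuth.refl _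
  | cons a w ih =>
    refine .trans ?_ (ih (h.insert (Nat.zero_le a.val)))
    simpa using (knuth_insert h.pairwise a).append_right w

theorem rowsFrom_tableau {n : ℕ} (w : Fin n → Fin d) : RowsFrom 0 (tableau w) :=
  RowsFrom.foldl_insert (T := []) trivial _

theorem knuth_tableau {n : ℕ} (w : Fin n → Fin d) :
    Knuth (List.ofFn w) (reading (tableau w)) :=
  RowsFrom.knuth_foldl_insert (T := []) trivial _

end Tableau

/-- The effect of appending the letter `a` to a word on the function `G`, where `G j` is the length
of the longest weakly increasing subsequence with letters between `k` and `j`. -/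
def lisStep {d : ℕ} (k : ℕ) (G : ℕ → ℕ) (a : Fin d) : ℕ → ℕ :=
  fun j => if k ≤ a ∧ a ≤ j then max (G j) (G a + 1) else G j

/-- The length of the longest weakly increasing subsequence of `w` without letters below `k`. -/
def lisFrom {d : ℕ} (k : ℕ) (w : List (Fin d)) : ℕ := w.foldl (lisStep k) 0 d

section Increasing

variable {d : ℕ} (k : ℕ)

theorem monotone_lisStep {G : ℕ → ℕ} (hG : Monotone G) (a : Fin d) :
    Monotone (lisStep k G a) := by
  intro i j hij
  have := hG hij
  simp only [lisStep]
  split_ifs <;> omega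

theorem lisStep_mono (a : Fin d) : Monotone fun G => lisStep k G a := by
  intro G H h j
  have hj : G j ≤ H j := h j
  have ha : G a ≤ H a := h a
  simp only [lisStep]
  split_ifs <;> omega

theorem le_lisStep (G : ℕ → ℕ) (a : Fin d) : G ≤ lisStep k G a := by
  intro j
  simp only [lisStep]
  split_ifs <;> omega

theorem lisStep_add_const (m : ℕ) (G : ℕ → ℕ) (a : Fin d) :
    lisStep k (fun j => G j + m) a = fun j => lisStep k G a j + m := by
  funext j
  simp only [lisStep]
  split_ifs <;> omega

theorem foldl_lisStep_eq_of_knuth {u v : List (Fin d)} (h : Knuth u v) :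
    u.foldl (lisStep k) 0 = v.foldl (lisStep k) 0 := by
  refine h.foldl_eq (Inv := Monotone) (fun G a hG => monotone_lisStep k hG a) ?_ ?_ _
    monotone_const
  · rintro G ⟨x, _⟩ ⟨y, _⟩ ⟨z, _⟩ - hxy hyz
    simp only [Fin.mk_le_mk, Fin.mk_lt_mk] at hxy hyz
    funext j
    simp only [lisStep]
    split_ifs <;> omega
  · rintro G ⟨x, _⟩ ⟨y, _⟩ ⟨z, _⟩ hG hxy hyz
    simp only [Fin.mk_le_mk, Fin.mk_lt_mk] at hxy hyz
    funext j
    have := hG hxy.le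
    simp only [lisStep]
    split_ifs <;> omega

theorem add_length_le_foldl_lisStep {G : ℕ → ℕ} (hG : Monotone G) {r w : List (Fin d)}
    (hrw : r.Sublist w) (hr : r.Pairwise (· ≤ ·)) (hk : ∀ a ∈ r, k ≤ a) {c j : ℕ} (hcj : c ≤ j)
    (hc : ∀ a ∈ r, c ≤ a) (hj : ∀ a ∈ r, a ≤ j) :
    G c + r.length ≤ w.foldl (lisStep k) G j := by
  induction hrw generalizing G c with
  | slnil => simpa using hG hcj
  | cons a _ ih =>
    exact (Nat.add_le_add_right (le_lisStep k G a c) _).trans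
      (ih (monotone_lisStep k hG a) hr hk hcj hc hj)
  | cons_cons a _ ih =>
    rw [List.pairwise_cons] at hr
    rw [List.forall_mem_cons] at hk hc hj
    have hstep : G c + 1 ≤ lisStep k G a a := by
      simpa [lisStep, hk.1] using hG hc.1
    have hrest := ih (monotone_lisStep k hG a) hr.2 hk.2 hj.1 hr.1 hj.2
    simp only [List.length_cons, List.foldl_cons]
    omega

theorem length_le_lisFrom {r w : List (Fin d)} (hrw : r.Sublist w) (hr : r.Pairwise (· ≤ ·))
    (hk : ∀ a ∈ r, k ≤ a) : r.length ≤ lisFrom k w := by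
  simpa [lisFrom] using add_length_le_foldl_lisStep k (G := 0) monotone_const hrw hr hk
    (Nat.zero_le d) (fun _ _ => Nat.zero_le _) fun a _ => a.isLt.le

theorem shape_le_lisFrom {n : ℕ} (w : Fin n → Fin d) (k : Fin d) :
    shape w k ≤ lisFrom k (List.ofFn w) := by
  have hrows := rowsFrom_tableau w
  rw [lisFrom, foldl_lisStep_eq_of_knuth k (knuth_tableau w)]
  exact length_le_lisFrom k (getD_sublist_reading _ _) (hrows.pairwise_getD k)
    fun a ha => by simpa using hrows.le_of_mem_getD k ha

end Increasing

/-- The effect of the letter `a` on a system of queues in series, where `c j` is the number of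
customers that have passed stage `j`. The letter `k` lets a new customer in, at stage `k`, and a
letter `a < k` lets a customer that has passed stage `a + 1`, if there is one waiting, pass
stage `a`. -/
def tandemStep {d : ℕ} (k : ℕ) (c : ℕ → ℕ) (a : Fin d) : ℕ → ℕ :=
  fun j => if a < k ∧ j = a then min (c j + 1) (c (j + 1))
    else if a = k ∧ k ≤ j then c j + 1 else c j

/-- The number of customers that have left the initially empty queues in series with entrance `k`
after the word `w`. -/
def throughput {d : ℕ} (k : ℕ) (w : List (Fin d)) : ℕ := w.foldl (tandemStep k) 0 0

section Tandem

variable {d : ℕ} (k : ℕ)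

theorem monotone_tandemStep {c : ℕ → ℕ} (hc : Monotone c) (a : Fin d) :
    Monotone (tandemStep k c a) := by
  refine monotone_nat_of_le_succ fun j => ?_
  have := hc (Nat.le_succ j)
  have := hc (Nat.le_succ (j + 1))
  simp only [tandemStep, Nat.succ_eq_add_one] at *
  split_ifs <;> omega

theorem tandemStep_mono (a : Fin d) : Monotone fun c => tandemStep k c a := by
  intro c e h j
  have h₀ : c j ≤ e j := h j
  have h₁ : c (j + 1) ≤ e (j + 1) := h (j + 1)
  simp only [tandemStep]
  split_ifs <;> omega

theorem tandemStep_add_const (m : ℕ) (c : ℕ → ℕ) (a : Fin d) :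
    tandemStep k (fun j => c j + m) a = fun j => tandemStep k c a j + m := by
  funext j
  simp only [tandemStep]
  split_ifs <;> omega

theorem foldl_tandemStep_eq_of_knuth {u v : List (Fin d)} (h : Knuth u v) :
    u.foldl (tandemStep k) 0 = v.foldl (tandemStep k) 0 := by
  refine h.foldl_eq (Inv := Monotone) (fun c a hc => monotone_tandemStep k hc a) ?_ ?_ _
    monotone_const
  all_goals
    rintro c ⟨x, _⟩ ⟨y, _⟩ ⟨z, _⟩ hc hxy hyz
    simp only [Fin.mk_le_mk, Fin.mk_lt_mk] at hxy hyz
    funext j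
    have := hc (Nat.le_succ j)
    have := hc (Nat.le_succ (j + 1))
    simp only [tandemStep, Nat.succ_eq_add_one] at *
    grind

theorem foldl_tandemStep_eq_of_lt (c : ℕ → ℕ) {i : ℕ} {r : List (Fin d)}
    (hr : ∀ a ∈ r, i < a) : r.foldl (tandemStep k) c i = c i := by
  induction r generalizing c with
  | nil => rfl
  | cons a r ih =>
    rw [List.forall_mem_cons] at hr
    rw [List.foldl_cons, ih _ hr.2]
    simp only [tandemStep]
    split_ifs <;> omega

theorem foldl_tandemStep_le_add_length (c : ℕ → ℕ) (i : ℕ) (r : List (Fin d)) :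
    r.foldl (tandemStep k) c i ≤ c i + r.length := by
  induction r generalizing c with
  | nil => simp
  | cons a r ih =>
    have hstep : tandemStep k c a i ≤ c i + 1 := by
      simp only [tandemStep]
      split_ifs <;> omega
    have hrest := ih (tandemStep k c a)
    simp only [List.length_cons, List.foldl_cons]
    omega

theorem foldl_tandemStep_le_of_pairwise {c : ℕ → ℕ} {i m : ℕ} (hi : i < k) (h₀ : c i ≤ m)
    (h₁ : c (i + 1) ≤ m) {r : List (Fin d)} (hr : r.Pairwise (· ≤ ·)) (hir : ∀ a ∈ r, i ≤ a) :
    r.foldl (tandemStep k) c i ≤ m := by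
  induction r generalizing c with
  | nil => exact h₀
  | cons a r ih =>
    rw [List.pairwise_cons] at hr
    rw [List.forall_mem_cons] at hir
    rcases hir.1.eq_or_lt with ha | ha
    · refine ih ?_ ?_ hr.2 hir.2 <;>
      · simp only [tandemStep]
        split_ifs <;> omega
    · rw [foldl_tandemStep_eq_of_lt k c]
      exacts [h₀, List.forall_mem_cons.mpr ⟨ha, fun b hb => ha.trans_le (hr.1 b hb)⟩]

theorem RowsFrom.foldl_tandemStep_reading_le {i : ℕ} {T : List (List (Fin d))} (h : RowsFrom i T)
    (hi : i ≤ k) :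
    (reading T).foldl (tandemStep k) 0 i ≤ (T.getD (k - i) []).length := by
  induction T generalizing i with
  | nil => simp [reading]
  | cons r T ih =>
    rw [reading_cons, List.foldl_append]
    rcases hi.eq_or_lt with rfl | hi
    · refine (foldl_tandemStep_le_add_length _ _ _ _).trans ?_
      rw [foldl_tandemStep_eq_of_lt _ _ fun a ha => h.2.2.le_of_mem_reading ha]
      simp
    · have hmono : Monotone ((reading T).foldl (tandemStep k) 0) :=
        List.foldlRecOn _ _ monotone_const fun _ hc a _ => monotone_tandemStep k hc a
      have hbelow := ih h.2.2 hi
      rw [show k - i = (k - (i + 1)) + 1 by omega, List.getD_cons_succ]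
      exact foldl_tandemStep_le_of_pairwise k hi ((hmono (Nat.le_succ i)).trans hbelow) hbelow
        h.1 h.2.1

theorem throughput_le_shape {n : ℕ} (w : Fin n → Fin d) (k : Fin d) :
    throughput k (List.ofFn w) ≤ shape w k := by
  rw [throughput, foldl_tandemStep_eq_of_knuth k (knuth_tableau w)]
  simpa [shape] using (rowsFrom_tableau w).foldl_tandemStep_reading_le k (Nat.zero_le _)

end Tandem

section FoldlMean

variable {ι : Type*} [MeasurableSpace ι] (μ : Measure ι)

/-- The mean of the `j`-th coordinate of the state reached from `c` by the successive actions of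
`n` independent letters of law `μ`. -/
noncomputable def foldlMean (act : (ℕ → ℕ) → ι → ℕ → ℕ) (j n : ℕ) (c : ℕ → ℕ) : ℝ≥0∞ :=
  ∫⁻ w : Fin n → ι, ((List.ofFn w).foldl act c j : ℕ) ∂Measure.pi fun _ => μ

variable {act : (ℕ → ℕ) → ι → ℕ → ℕ} {j n : ℕ} {c e : ℕ → ℕ}

theorem foldlMean_mono (hmono : ∀ a, Monotone fun c => act c a) (h : c ≤ e) :
    foldlMean μ act j n c ≤ foldlMean μ act j n e :=
  lintegral_mono fun w => by exact Nat.cast_le.mpr (List.foldl_monotone hmono (List.ofFn w) h j)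

theorem lintegral_pi_succ [SigmaFinite μ] [Fintype ι] [MeasurableSingletonClass ι]
    (F : (Fin (n + 1) → ι) → ℝ≥0∞) :
    ∫⁻ w, F w ∂Measure.pi (fun _ => μ) =
      ∑ a, μ {a} * ∫⁻ w : Fin n → ι, F (Fin.cons a w) ∂Measure.pi fun _ => μ := by
  simp only [lintegral_fintype, Measure.pi_singleton, Finset.mul_sum]
  rw [← (Fin.consEquiv fun _ => ι).sum_comp, Fintype.sum_prod_type]
  refine Finset.sum_congr rfl fun a _ => Finset.sum_congr rfl fun w _ => ?_
  change F (Fin.cons a w) * ∏ i, μ {(Fin.cons a w : Fin (n + 1) → ι) i} = _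
  rw [Fin.prod_univ_succ]
  simp only [Fin.cons_zero, Fin.cons_succ]
  ring

theorem foldlMean_succ [SigmaFinite μ] [Fintype ι] [MeasurableSingletonClass ι] :
    foldlMean μ act j (n + 1) c = ∑ a, μ {a} * foldlMean μ act j n (act c a) := by
  simp only [foldlMean, lintegral_pi_succ, List.ofFn_cons, List.foldl_cons]

variable [IsProbabilityMeasure μ]

theorem foldlMean_zero : foldlMean μ act j 0 c = c j := by simp [foldlMean]

theorem foldlMean_add_const (hadd : ∀ m c a, act (fun i => c i + m) a = fun i => act c a i + m)
    (m : ℕ) : foldlMean μ act j n (fun i => c i + m) = foldlMean μ act j n c + m := by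
  have hfold (w : List ι) : w.foldl act (fun i => c i + m) = fun i => w.foldl act c i + m :=
    List.foldl_hom (fun (c : ℕ → ℕ) i => c i + m) (fun c a => (hadd m c a))
  simp [foldlMean, hfold, lintegral_add_right _ measurable_const]

theorem foldlMean_le_add (hmono : ∀ a, Monotone fun c => act c a)
    (hadd : ∀ m c a, act (fun i => c i + m) a = fun i => act c a i + m) {m : ℕ}
    (h : ∀ i, c i ≤ e i + m) :
    foldlMean μ act j n c ≤ foldlMean μ act j n e + m :=
  (foldlMean_mono μ hmono h).trans (foldlMean_add_const μ hadd m).le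

end FoldlMean

section Geometric

/-- The expectation of `f` under the geometric law with weights `(1 - r) * r ^ n`. -/
noncomputable def geomE (r : ℝ≥0∞) (f : ℕ → ℝ≥0∞) : ℝ≥0∞ := ∑' n, (1 - r) * r ^ n * f n

/-- The expectation of `φ` under the law of a list of `m` independent geometric variables with
parameters `r 0, r 1, …`. -/
noncomputable def geomListE : {m : ℕ} → (Fin m → ℝ≥0∞) → (List ℕ → ℝ≥0∞) → ℝ≥0∞
  | 0, _, φ => φ []
  | _ + 1, r, φ => geomE (r 0) fun n => geomListE (fun i => r i.succ) fun y => φ (n :: y)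

theorem geomE_add (r : ℝ≥0∞) (f g : ℕ → ℝ≥0∞) :
    geomE r (fun n => f n + g n) = geomE r f + geomE r g := by
  simp only [geomE, mul_add, ENNReal.tsum_add]

theorem geomE_const_mul (r c : ℝ≥0∞) (f : ℕ → ℝ≥0∞) :
    geomE r (fun n => c * f n) = c * geomE r f := by
  simp only [geomE, ← ENNReal.tsum_mul_left, mul_left_comm]

theorem geomE_mono (r : ℝ≥0∞) : Monotone (geomE r) := fun _ _ h =>
  ENNReal.tsum_le_tsum fun n => mul_le_mul_right (h n) _

theorem geomE_const {r : ℝ≥0∞} (hr : r < 1) (c : ℝ≥0∞) : geomE r (fun _ => c) = c := by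
  rw [geomE, ENNReal.tsum_mul_right, ENNReal.tsum_mul_left, ENNReal.tsum_geometric,
    ENNReal.mul_inv_cancel (tsub_pos_of_lt hr).ne' (by simp), one_mul]

theorem geomE_eq_zero_add (r : ℝ≥0∞) (f : ℕ → ℝ≥0∞) :
    geomE r f = (1 - r) * f 0 + r * geomE r (fun n => f (n + 1)) := by
  rw [geomE, tsum_eq_zero_add' ENNReal.summable, geomE, ← ENNReal.tsum_mul_left]
  congr 1
  · simp
  · exact tsum_congr fun n => by ring

theorem geomE_natCast {r : ℝ≥0∞} (hr : r < 1) : geomE r (fun n => (n : ℝ≥0∞)) = r / (1 - r) := by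
  lift r to NNReal using (hr.trans ENNReal.one_lt_top).ne
  have hr₁ : (0 : ℝ) < 1 - r := sub_pos.mpr (by exact_mod_cast hr)
  have hsum := (hasSum_coe_mul_geometric_of_norm_lt_one (r := (r : ℝ))
    (by simpa using hr)).mul_left (1 - (r : ℝ))
  have hterm (n : ℕ) : (1 - (r : ℝ≥0∞)) * (r : ℝ≥0∞) ^ n * n =
      ENNReal.ofReal ((1 - (r : ℝ)) * (n * (r : ℝ) ^ n)) := by
    rw [ENNReal.ofReal_mul hr₁.le, ENNReal.ofReal_mul (by positivity),
      ENNReal.ofReal_sub _ (by positivity), ENNReal.ofReal_pow (by positivity)]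
    simp only [ENNReal.ofReal_one, ENNReal.ofReal_coe_nnreal, ENNReal.ofReal_natCast]
    ring
  rw [geomE, tsum_congr hterm, ← ENNReal.ofReal_tsum_of_nonneg (fun n => by positivity)
    hsum.summable, hsum.tsum_eq, show (1 - (r : ℝ)) * (r / (1 - r) ^ 2) = r / (1 - r) by field_simp,
    ENNReal.ofReal_div_of_pos hr₁, ENNReal.ofReal_sub _ (by positivity)]
  simp

variable {m : ℕ} {r : Fin m → ℝ≥0∞}

theorem geomListE_add (φ ψ : List ℕ → ℝ≥0∞) :
    geomListE r (fun x => φ x + ψ x) = geomListE r φ + geomListE r ψ := by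
  induction m generalizing φ ψ with
  | zero => rfl
  | succ m ih => simp only [geomListE, ih, geomE_add]

theorem geomListE_const_mul (c : ℝ≥0∞) (φ : List ℕ → ℝ≥0∞) :
    geomListE r (fun x => c * φ x) = c * geomListE r φ := by
  induction m generalizing φ with
  | zero => rfl
  | succ m ih => simp only [geomListE, ih, geomE_const_mul]

theorem geomListE_sum {ι : Type*} (s : Finset ι) (φ : ι → List ℕ → ℝ≥0∞) :
    geomListE r (fun x => ∑ i ∈ s, φ i x) = ∑ i ∈ s, geomListE r (φ i) := by
  classical
  induction s using Finset.induction_on with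
  | empty => simpa using geomListE_const_mul (r := r) 0 (fun _ => 0)
  | insert i s hi ih => simp only [Finset.sum_insert hi, geomListE_add, ih]

theorem geomListE_mono {φ ψ : List ℕ → ℝ≥0∞} (h : ∀ x, x.length = m → φ x ≤ ψ x) :
    geomListE r φ ≤ geomListE r ψ := by
  induction m generalizing φ ψ with
  | zero => exact h [] rfl
  | succ m ih => exact geomE_mono _ fun n => ih fun y hy => h (n :: y) (by simp [hy])

theorem geomListE_congr {φ ψ : List ℕ → ℝ≥0∞} (h : ∀ x, x.length = m → φ x = ψ x) :
    geomListE r φ = geomListE r ψ :=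
  (geomListE_mono fun x hx => (h x hx).le).antisymm (geomListE_mono fun x hx => (h x hx).ge)

theorem geomListE_const (hr : ∀ i, r i < 1) (c : ℝ≥0∞) : geomListE r (fun _ => c) = c := by
  induction m with
  | zero => rfl
  | succ m ih => simp only [geomListE, ih fun i => hr i.succ, geomE_const (hr 0)]

theorem geomListE_natCast_sum (hr : ∀ i, r i < 1) :
    geomListE r (fun x => (x.sum : ℝ≥0∞)) = ∑ i, r i / (1 - r i) := by
  induction m with
  | zero => simp [geomListE]
  | succ m ih =>
    simp only [geomListE, List.sum_cons, Nat.cast_add, geomListE_add, ih fun i => hr i.succ,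
      geomListE_const fun i => hr i.succ, geomE_add, geomE_const (hr 0), geomE_natCast (hr 0),
      Fin.sum_univ_succ]

theorem geomE_sum_geomListE_succ {r : Fin (m + 1) → ℝ≥0∞} {ι : Type*} [Fintype ι] (s : ι → ℝ≥0∞)
    (φ : ι → List ℕ → ℝ≥0∞) :
    geomE (r 0) (fun n => ∑ i, s i * geomListE (fun j => r j.succ) fun y => φ i (n :: y)) =
      ∑ i, s i * geomListE r (φ i) := by
  simp only [← geomListE_const_mul, ← geomListE_sum]
  rfl

end Geometric

/-- The number of letters up to `j` in the row in which the letter `i` occurs `x[i]` times. -/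
def countUpTo (x : List ℕ) : ℕ → ℕ := fun j => (x.take (j + 1)).sum

section CountUpTo

theorem countUpTo_cons_zero (n : ℕ) (y : List ℕ) : countUpTo (n :: y) 0 = n := by
  simp [countUpTo]

theorem countUpTo_cons_succ (n : ℕ) (y : List ℕ) (j : ℕ) :
    countUpTo (n :: y) (j + 1) = n + countUpTo y j := by
  simp [countUpTo]

theorem countUpTo_of_length_le {x : List ℕ} {j : ℕ} (h : x.length ≤ j + 1) :
    countUpTo x j = x.sum := by
  rw [countUpTo, List.take_of_length_le h]

theorem countUpTo_le_sum (x : List ℕ) (j : ℕ) : countUpTo x j ≤ x.sum :=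
  (List.take_sublist _ _).sum_le_sum fun _ _ => Nat.zero_le _

end CountUpTo

/-- Remove the smallest letter of the row in which the letter `i` occurs `x[i]` times. -/
def removeMin : List ℕ → List ℕ
  | [] => []
  | 0 :: y => 0 :: removeMin y
  | (n + 1) :: y => n :: y

/-- Insert the letter `i` into the row in which each letter `j` occurs `x[j]` times: it bumps the
smallest larger letter. -/
def insertCount : ℕ → List ℕ → List ℕ
  | _, [] => []
  | 0, n :: y => (n + 1) :: removeMin y
  | i + 1, n :: y => n :: insertCount i y

section RowChain

theorem countUpTo_removeMin (x : List ℕ) (j : ℕ) :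
    countUpTo (removeMin x) j = countUpTo x j - 1 := by
  induction x generalizing j with
  | nil => simp [removeMin, countUpTo]
  | cons n y ih =>
    rcases n with - | n <;> rcases j with - | j <;>
      simp [removeMin, countUpTo_cons_zero, countUpTo_cons_succ, ih]

theorem countUpTo_insertCount {x : List ℕ} {i : ℕ} (hi : i < x.length) (j : ℕ) :
    countUpTo (insertCount i x) j =
      if i ≤ j then max (countUpTo x j) (countUpTo x i + 1) else countUpTo x j := by
  induction x generalizing i j with
  | nil => simp at hi
  | cons n y ih =>
    rcases i with - | i <;> rcases j with - | j
    · simp [insertCount, countUpTo_cons_zero]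
    · simp only [insertCount, countUpTo_cons_zero, countUpTo_cons_succ, countUpTo_removeMin,
        Nat.zero_le, if_true]
      omega
    · simp [insertCount, countUpTo_cons_zero]
    · simp only [insertCount, countUpTo_cons_succ, ih (Nat.lt_of_succ_lt_succ hi),
        Nat.add_le_add_iff_right]
      split_ifs <;> omega

theorem lisStep_countUpTo {d k : ℕ} {x : List ℕ} (hx : x.length = d) {a : Fin d} (ha : k ≤ a) :
    lisStep k (countUpTo x) a = countUpTo (insertCount a x) := by
  funext j
  simp only [lisStep, ha, true_and, countUpTo_insertCount (hx.symm ▸ a.isLt : (a : ℕ) < x.length)]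

theorem lisStep_of_lt {d k : ℕ} (G : ℕ → ℕ) {a : Fin d} (ha : a < k) : lisStep k G a = G := by
  funext j
  simp [lisStep, ha.not_ge]

/-- The product of geometric laws is stationary for the row to which each letter `i` is added
at the rate `r i` and whose smallest letter is removed at the rate `1`. -/
theorem geomListE_insertCount {m : ℕ} (r : Fin m → ℝ≥0∞) (φ : List ℕ → ℝ≥0∞) :
    geomListE r (fun x => φ (removeMin x)) +
        ∑ i, r i * geomListE r (fun x => φ (insertCount i x)) =
      (1 + ∑ i, r i) * geomListE r φ := by
  induction m generalizing φ with
  | zero => simp [geomListE, removeMin]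
  | succ m ih =>
    set r' : Fin m → ℝ≥0∞ := fun i => r i.succ
    set A : ℕ → ℝ≥0∞ := fun n => geomListE r' fun y => φ (n :: y)
    set B : ℕ → ℝ≥0∞ := fun n => geomListE r' fun y => φ (n :: removeMin y)
    set C : ℕ → ℝ≥0∞ := fun n => ∑ i, r' i * geomListE r' fun y => φ (n :: insertCount i y)
    have hBC : ∀ n, B n + C n = (1 + ∑ i, r' i) * A n := fun n => ih r' fun y => φ (n :: y)
    have hremove : geomListE r (fun x => φ (removeMin x)) =
        (1 - r 0) * B 0 + r 0 * geomE (r 0) A := geomE_eq_zero_add _ _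
    have hfirst : geomListE r (fun x => φ (insertCount 0 x)) = geomE (r 0) fun n => B (n + 1) := rfl
    have hrest : ∑ i : Fin m, r i.succ * geomListE r (fun x => φ (insertCount i.succ x)) =
        geomE (r 0) C := (geomE_sum_geomListE_succ _ _).symm
    rw [Fin.sum_univ_succ, Fin.sum_univ_succ, hremove, hrest]
    calc _ = ((1 - r 0) * B 0 + r 0 * geomE (r 0) fun n => B (n + 1)) + geomE (r 0) C
          + r 0 * geomE (r 0) A := by rw [Fin.val_zero, hfirst]; ring
      _ = geomE (r 0) (fun n => B n + C n) + r 0 * geomE (r 0) A := by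
        rw [← geomE_eq_zero_add, geomE_add]
      _ = (1 + (r 0 + ∑ i, r' i)) * geomE (r 0) A := by
        simp only [hBC, geomE_const_mul]
        ring

end RowChain

/-- Move a customer, if there is one, from the entry `i + 1` of `x` to the entry `i`. -/
def transfer : ℕ → List ℕ → List ℕ
  | _, [] => []
  | 0, [o] => [o]
  | 0, o :: 0 :: y => o :: 0 :: y
  | 0, o :: (n + 1) :: y => (o + 1) :: n :: y
  | i + 1, o :: y => o :: transfer i y

section QueueChain

theorem countUpTo_transfer {x : List ℕ} {i : ℕ} (hi : i + 1 < x.length) (j : ℕ) :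
    countUpTo (transfer i x) j =
      if j = i then min (countUpTo x i + 1) (countUpTo x (i + 1)) else countUpTo x j := by
  induction i generalizing x j with
  | zero =>
    match x, hi with
    | o :: 0 :: y, _ =>
      rcases j with - | j <;> simp [transfer, countUpTo_cons_zero, countUpTo_cons_succ]
    | o :: (n + 1) :: y, _ =>
      rcases j with - | - | j <;> simp [transfer, countUpTo_cons_zero, countUpTo_cons_succ] <;>
        omega
  | succ i ih =>
    match x, hi with
    | o :: y, hi =>
      rcases j with - | j
      · simp [transfer, countUpTo_cons_zero]
      · simp only [transfer, countUpTo_cons_succ, ih (Nat.lt_of_succ_lt_succ hi),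
          Nat.add_right_cancel_iff]
        split_ifs <;> omega

theorem countUpTo_modify_succ {x : List ℕ} {i : ℕ} (hi : i < x.length) (j : ℕ) :
    countUpTo (x.modify i (· + 1)) j = if i ≤ j then countUpTo x j + 1 else countUpTo x j := by
  induction x generalizing i j with
  | nil => simp at hi
  | cons n y ih =>
    rcases i with - | i <;> rcases j with - | j
    · simp [countUpTo_cons_zero]
    · simp [countUpTo_cons_succ, add_right_comm]
    · simp [countUpTo_cons_zero]
    · simp only [List.modify_succ_cons, countUpTo_cons_succ, ih (Nat.lt_of_succ_lt_succ hi),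
        Nat.add_le_add_iff_right]
      split_ifs <;> omega

variable {d k : ℕ} {x : List ℕ} {a : Fin d}

theorem tandemStep_countUpTo_of_lt (hx : x.length = k + 1) (ha : a < k) :
    tandemStep k (countUpTo x) a = countUpTo (transfer a x) := by
  funext j
  rw [countUpTo_transfer (by omega)]
  simp only [tandemStep]
  split_ifs <;> grind

theorem tandemStep_countUpTo_of_eq (hx : x.length = k + 1) (ha : a = k) :
    tandemStep k (countUpTo x) a = countUpTo (x.modify k (· + 1)) := by
  funext j
  rw [countUpTo_modify_succ (by omega)]
  simp [tandemStep, ha]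

theorem tandemStep_of_gt (c : ℕ → ℕ) (ha : k < a) : tandemStep k c a = c := by
  funext j
  simp [tandemStep, ha.ne', ha.not_gt]

/-- The product of geometric laws is stationary for queues in series with service rates `s i`
and arrivals at the rate `1`, and the customers then leave the system at the rate `1`. The queue
lengths are the entries of `y`, and `o` is the number of customers that have left. -/
theorem geomListE_transfer {m : ℕ} {r s : Fin m → ℝ≥0∞} (hrs : ∀ i, s i * r i = 1)
    (φ : List ℕ → ℝ≥0∞) (o : ℕ) :
    geomListE r (fun y => φ ((o :: y).modify m (· + 1))) +
        ∑ i, s i * geomListE r (fun y => φ (transfer i (o :: y))) =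
      (∑ i, s i) * geomListE r (fun y => φ (o :: y)) + geomListE r fun y => φ ((o + 1) :: y) := by
  induction m generalizing φ o with
  | zero => simp [geomListE]
  | succ m ih =>
    set r' : Fin m → ℝ≥0∞ := fun i => r i.succ
    set s' : Fin m → ℝ≥0∞ := fun i => s i.succ
    set A : ℕ → ℝ≥0∞ := fun n => geomListE r' fun y => φ (o :: n :: y)
    set B : ℕ → ℝ≥0∞ := fun n => geomListE r' fun y => φ (o :: (n :: y).modify m (· + 1))
    set C : ℕ → ℝ≥0∞ := fun n => ∑ i, s' i * geomListE r' fun y => φ (o :: transfer i (n :: y))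
    set D : ℝ≥0∞ := geomListE r fun y => φ ((o + 1) :: y)
    have hBC : ∀ n, B n + C n = (∑ i, s' i) * A n + A (n + 1) :=
      ih (fun i => hrs i.succ) fun y => φ (o :: y)
    have harrive : geomListE r (fun y => φ ((o :: y).modify (m + 1) (· + 1))) = geomE (r 0) B := rfl
    have hfirst : geomListE r (fun y => φ (transfer 0 (o :: y))) = (1 - r 0) * A 0 + r 0 * D :=
      geomE_eq_zero_add _ _
    have hrest : ∑ i : Fin m, s i.succ * geomListE r (fun y => φ (transfer i.succ (o :: y))) =
        geomE (r 0) C := by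
      simpa only [Fin.val_succ, transfer] using
        (geomE_sum_geomListE_succ (r := r) s' fun i x => φ (transfer i.succ (o :: x))).symm
    rw [Fin.sum_univ_succ, Fin.sum_univ_succ, harrive, hrest, Fin.val_zero, hfirst]
    calc _ = geomE (r 0) (fun n => B n + C n) + s 0 * ((1 - r 0) * A 0) + s 0 * r 0 * D := by
          rw [geomE_add]; ring
      _ = (∑ i, s' i) * geomE (r 0) A
          + (s 0 * r 0 * geomE (r 0) (fun n => A (n + 1)) + s 0 * ((1 - r 0) * A 0)) + D := by
        simp only [hBC, geomE_add, geomE_const_mul, hrs, one_mul]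
        ring
      _ = (∑ i, s' i) * geomE (r 0) A + s 0 * geomE (r 0) A + D := by
        rw [geomE_eq_zero_add (r 0) A]
        ring
      _ = (s 0 + ∑ i, s' i) * geomE (r 0) A + D := by ring

end QueueChain

section RowMean

variable {d : ℕ} (μ : Measure (Fin d)) (k : ℕ) (r : Fin d → ℝ≥0∞)

/-- The mean of the longest weakly increasing subsequence of `n` independent letters of law `μ`
inserted from the letter `k` on into a row that contains each letter `i` a geometric number of
times, with parameter `r i`. -/
noncomputable def rowMean (n : ℕ) : ℝ≥0∞ :=
  geomListE r fun x => foldlMean μ (lisStep k) d n (countUpTo x)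

variable {μ k r} {n : ℕ} {p : ℝ≥0∞}

theorem foldlMean_le_rowMean (hr : ∀ i, r i < 1) :
    foldlMean μ (lisStep k) d n 0 ≤ rowMean μ k r n := by
  rw [← geomListE_const hr (foldlMean μ (lisStep k) d n 0), rowMean]
  exact geomListE_mono fun x _ => foldlMean_mono μ (lisStep_mono k) fun _ => Nat.zero_le _

variable [IsProbabilityMeasure μ]

theorem rowMean_zero (hr : ∀ i, r i < 1) : rowMean μ k r 0 = ∑ i, r i / (1 - r i) := by
  rw [← geomListE_natCast_sum hr, rowMean]
  refine geomListE_congr fun x hx => ?_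
  rw [foldlMean_zero, countUpTo_of_length_le (by omega)]

/-- By stationarity, a row that loses its smallest letter at the rate `p` between the insertions
keeps its law; a single loss shortens the final row by at most one. -/
theorem rowMean_succ_le (hr : ∀ i, r i < 1) (hp : p ≠ ⊤) (hlow : ∀ i : Fin d, i < k → r i = 0)
    (hμ : ∀ i : Fin d, k ≤ i → μ {i} = p * r i) (hfin : rowMean μ k r n ≠ ⊤) :
    rowMean μ k r (n + 1) ≤ p + rowMean μ k r n := by
  set V : (ℕ → ℕ) → ℝ≥0∞ := foldlMean μ (lisStep k) d n
  set G : ℝ≥0∞ := rowMean μ k r n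
  set K : ℝ≥0∞ := geomListE r fun x => V (countUpTo (removeMin x))
  set I : Fin d → ℝ≥0∞ := fun a => geomListE r fun x => V (countUpTo (insertCount a x))
  have hletter (a : Fin d) :
      μ {a} * geomListE r (fun x => V (lisStep k (countUpTo x) a)) + p * (r a * G) =
        μ {a} * G + p * (r a * I a) := by
    rcases lt_or_ge (a : ℕ) k with ha | ha
    · simp only [lisStep_of_lt _ ha, hlow a ha, zero_mul, mul_zero, add_zero]
      rfl
    · rw [geomListE_congr fun x hx => by rw [lisStep_countUpTo hx ha], hμ a ha]
      ring
  have hstep : rowMean μ k r (n + 1) + p * ((∑ a, r a) * G) = G + p * ∑ a, r a * I a := by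
    simp only [rowMean, foldlMean_succ, geomListE_sum, geomListE_const_mul]
    rw [Finset.sum_mul, Finset.mul_sum, Finset.mul_sum, ← Finset.sum_add_distrib,
      Finset.sum_congr rfl fun a _ => hletter a, Finset.sum_add_distrib, ← Finset.sum_mul,
      sum_measure_singleton, Finset.coe_univ, measure_univ, one_mul]
  have hstat : K + ∑ a, r a * I a = (1 + ∑ a, r a) * G :=
    geomListE_insertCount r fun x => V (countUpTo x)
  have hremove : G ≤ K + 1 := by
    rw [← geomListE_const hr 1, ← geomListE_add]
    refine geomListE_mono fun x _ => ?_
    exact_mod_cast foldlMean_le_add μ (lisStep_mono k) (lisStep_add_const k) (m := 1)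
      fun j => by rw [countUpTo_removeMin]; omega
  have hsum : ∑ a, r a ≠ ⊤ := ENNReal.sum_ne_top.mpr fun i _ => (hr i).ne_top
  refine (ENNReal.add_le_add_iff_right (a := p * ((1 + ∑ a, r a) * G)) (by finiteness)).mp ?_
  calc _ = (rowMean μ k r (n + 1) + p * ((∑ a, r a) * G)) + p * G := by ring
    _ ≤ (G + p * ∑ a, r a * I a) + p * (K + 1) := by rw [hstep]; gcongr
    _ = p + G + p * (K + ∑ a, r a * I a) := by ring
    _ = _ := by rw [hstat]

theorem rowMean_le (hr : ∀ i, r i < 1) (hp : p ≠ ⊤) (hlow : ∀ i : Fin d, i < k → r i = 0)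
    (hμ : ∀ i : Fin d, k ≤ i → μ {i} = p * r i) (n : ℕ) :
    rowMean μ k r n ≤ p * n + ∑ i, r i / (1 - r i) := by
  have hfin : ∑ i, r i / (1 - r i) ≠ ⊤ := ENNReal.sum_ne_top.mpr fun i _ =>
    ENNReal.div_ne_top (hr i).ne_top (tsub_pos_of_lt (hr i)).ne'
  induction n with
  | zero => simp [rowMean_zero hr]
  | succ n ih =>
    calc rowMean μ k r (n + 1) ≤ p + rowMean μ k r n :=
          rowMean_succ_le hr hp hlow hμ (ne_top_of_le_ne_top (by finiteness) ih)
      _ ≤ p + (p * n + ∑ i, r i / (1 - r i)) := by gcongr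
      _ = p * (n + 1 : ℕ) + ∑ i, r i / (1 - r i) := by push_cast; ring

end RowMean

theorem sum_castLE_add_add_sum_Ioi {M : Type*} [AddCommMonoid M] {d : ℕ} (k : Fin d)
    (f : Fin d → M) :
    ∑ i : Fin k, f (i.castLE k.isLt.le) + (f k + ∑ a ∈ Finset.Ioi k, f a) = ∑ a, f a := by
  have hIio : Finset.Iio k = Finset.univ.map (Fin.castLEEmb k.isLt.le) := by
    ext a
    simp only [Finset.mem_Iio, Finset.mem_map, Finset.mem_univ, true_and, Fin.castLEEmb_apply]
    exact ⟨fun h => ⟨⟨a, h⟩, rfl⟩, fun ⟨i, hi⟩ => hi ▸ i.isLt⟩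
  rw [Finset.add_sum_Ioi_eq_sum_Ici, ← Finset.sum_filter_add_sum_filter_not Finset.univ (· < k),
    Finset.filter_gt_eq_Iio, hIio, Finset.sum_map]
  simp only [not_lt, Finset.filter_le_eq_Ici, Fin.castLEEmb_apply]

section QueueMean

variable {d : ℕ} (μ : Measure (Fin d)) (k : Fin d) (r : Fin k → ℝ≥0∞)

/-- The mean number of customers that have left the queues in series with entrance `k` after `n`
independent letters of law `μ`, if the queue at `i` starts with a geometric number of customers,
with parameter `r i`. -/
noncomputable def queueMean (n : ℕ) : ℝ≥0∞ :=
  geomListE r fun y => foldlMean μ (tandemStep k) 0 n (countUpTo (0 :: y))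

/-- The mean of the number of departures in `queueMean` if the `n` letters follow the letter `a`. -/
noncomputable def queueMeanAfter (n : ℕ) (a : Fin d) : ℝ≥0∞ :=
  geomListE r fun y => foldlMean μ (tandemStep k) 0 n (tandemStep k (countUpTo (0 :: y)) a)

variable {μ k r}

theorem queueMeanAfter_castLE (n : ℕ) (i : Fin k) :
    queueMeanAfter μ k r n (i.castLE k.isLt.le) = geomListE r fun y =>
      foldlMean μ (tandemStep k) 0 n (countUpTo (transfer i (0 :: y))) :=
  geomListE_congr fun y hy => by
    rw [tandemStep_countUpTo_of_lt (by simp [hy]) (by simp), Fin.val_castLE]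

theorem queueMeanAfter_self (n : ℕ) :
    queueMeanAfter μ k r n k = geomListE r fun y =>
      foldlMean μ (tandemStep k) 0 n (countUpTo ((0 :: y).modify k (· + 1))) :=
  geomListE_congr fun y hy => by rw [tandemStep_countUpTo_of_eq (by simp [hy]) rfl]

theorem queueMeanAfter_of_gt (n : ℕ) {a : Fin d} (ha : k < a) :
    queueMeanAfter μ k r n a = queueMean μ k r n :=
  geomListE_congr fun y _ => by rw [tandemStep_of_gt _ (Fin.lt_def.mp ha)]

theorem queueMean_le_queueMeanAfter_self (n : ℕ) :
    queueMean μ k r n ≤ queueMeanAfter μ k r n k := by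
  rw [queueMeanAfter_self]
  refine geomListE_mono fun y hy => foldlMean_mono μ (tandemStep_mono k) fun j => ?_
  rw [countUpTo_modify_succ (by simp [hy])]
  grind

variable [IsProbabilityMeasure μ] {s : Fin k → ℝ≥0∞} {p : ℝ≥0∞}

theorem queueMean_succ (n : ℕ) :
    queueMean μ k r (n + 1) = ∑ a, μ {a} * queueMeanAfter μ k r n a := by
  simp only [queueMean, queueMeanAfter, foldlMean_succ, geomListE_sum, geomListE_const_mul]

theorem queueMeanAfter_self_add_sum (hr : ∀ i, r i < 1) (hrs : ∀ i, s i * r i = 1) (n : ℕ) :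
    queueMeanAfter μ k r n k + ∑ i, s i * queueMeanAfter μ k r n (i.castLE k.isLt.le) =
      (∑ i, s i) * queueMean μ k r n + (queueMean μ k r n + 1) := by
  have hleft (y : List ℕ) : countUpTo (1 :: y) = fun j => countUpTo (0 :: y) j + 1 := by
    funext j
    rcases j with - | j <;> simp [countUpTo_cons_zero, countUpTo_cons_succ, add_comm]
  have hadd : queueMean μ k r n + 1 =
      geomListE r fun y => foldlMean μ (tandemStep k) 0 n (countUpTo (1 :: y)) := by
    simp only [hleft, foldlMean_add_const μ (tandemStep_add_const k), geomListE_add,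
      geomListE_const hr, Nat.cast_one]
    rfl
  simp only [queueMeanAfter_self, queueMeanAfter_castLE, hadd]
  exact geomListE_transfer hrs (fun x => foldlMean μ (tandemStep k) 0 n (countUpTo x)) 0

/-- By stationarity the first letter only adds departures, at the rate `p`; an arrival beyond this
rate cannot decrease the number of departures. -/
theorem add_queueMean_le_queueMean_succ (hr : ∀ i, r i < 1) (hrs : ∀ i, s i * r i = 1)
    (hμ : ∀ i : Fin k, μ {i.castLE k.isLt.le} = p * s i) (hk : p ≤ μ {k}) (n : ℕ) :
    p + queueMean μ k r n ≤ queueMean μ k r (n + 1) := by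
  set G : ℝ≥0∞ := queueMean μ k r n
  set E : Fin d → ℝ≥0∞ := queueMeanAfter μ k r n
  have htotal : p * ∑ i, s i + (μ {k} + ∑ a ∈ Finset.Ioi k, μ {a}) = 1 := by
    rw [Finset.mul_sum, ← Finset.sum_congr rfl fun i _ => hμ i,
      sum_castLE_add_add_sum_Ioi k fun a => μ {a}, sum_measure_singleton, Finset.coe_univ,
      measure_univ]
  have hidle : ∑ a ∈ Finset.Ioi k, μ {a} * E a = (∑ a ∈ Finset.Ioi k, μ {a}) * G := by
    rw [Finset.sum_mul]
    exact Finset.sum_congr rfl fun a ha =>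
      congrArg _ (queueMeanAfter_of_gt n (Finset.mem_Ioi.mp ha))
  obtain ⟨ε, hε⟩ := exists_add_of_le hk
  calc p + G = p + (p * ∑ i, s i + (μ {k} + ∑ a ∈ Finset.Ioi k, μ {a})) * G := by
          rw [htotal, one_mul]
    _ = p * ((∑ i, s i) * G + (G + 1)) + (ε * G + (∑ a ∈ Finset.Ioi k, μ {a}) * G) := by
      rw [hε]; ring
    _ ≤ p * (E k + ∑ i, s i * E (i.castLE k.isLt.le)) +
        (ε * E k + (∑ a ∈ Finset.Ioi k, μ {a}) * G) := by
      rw [queueMeanAfter_self_add_sum hr hrs]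
      gcongr
      exact queueMean_le_queueMeanAfter_self n
    _ = p * (∑ i, s i * E (i.castLE k.isLt.le)) +
        (μ {k} * E k + ∑ a ∈ Finset.Ioi k, μ {a} * E a) := by
      rw [hidle, hε]; ring
    _ = ∑ a, μ {a} * E a := by
      rw [← sum_castLE_add_add_sum_Ioi k, Finset.mul_sum]
      simp only [hμ, mul_assoc]
    _ = queueMean μ k r (n + 1) := (queueMean_succ n).symm

theorem mul_le_queueMean (hr : ∀ i, r i < 1) (hrs : ∀ i, s i * r i = 1)
    (hμ : ∀ i : Fin k, μ {i.castLE k.isLt.le} = p * s i) (hk : p ≤ μ {k}) (n : ℕ) :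
    p * n ≤ queueMean μ k r n := by
  induction n with
  | zero => simp
  | succ n ih =>
    calc p * (n + 1 : ℕ) = p + p * n := by push_cast; ring
      _ ≤ p + queueMean μ k r n := by gcongr
      _ ≤ _ := add_queueMean_le_queueMean_succ hr hrs hμ hk n

theorem queueMean_le (hr : ∀ i, r i < 1) (n : ℕ) :
    queueMean μ k r n ≤ foldlMean μ (tandemStep k) 0 n 0 + ∑ i, r i / (1 - r i) := by
  rw [← geomListE_natCast_sum hr, ← geomListE_const hr (foldlMean μ (tandemStep k) 0 n 0),
    ← geomListE_add]
  exact geomListE_mono fun y _ => foldlMean_le_add μ (tandemStep_mono k) (tandemStep_add_const k)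
    fun j => by simpa using countUpTo_le_sum (0 :: y) j

end QueueMean

section Drift

theorem div_div_one_sub_le {x δ p : ℝ≥0∞} (hδ : δ ≠ 0) (hp : p ≠ ⊤) (h : x + δ ≤ p) :
    x / p / (1 - x / p) ≤ x / δ := by
  have hp₀ : p ≠ 0 := ne_bot_of_le_ne_bot hδ (le_add_self.trans h)
  have hsub : δ / p ≤ 1 - x / p := by
    refine ENNReal.le_sub_of_add_le_left (ENNReal.div_ne_top (ne_top_of_le_ne_top hp
      (le_self_add.trans h)) hp₀) ?_
    rw [← ENNReal.add_div]
    exact ENNReal.div_le_of_le_mul (by rwa [one_mul])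
  calc x / p / (1 - x / p) ≤ x / p / (δ / p) := ENNReal.div_le_div_left hsub _
    _ = x / δ := ENNReal.mul_div_mul_right _ _ (by simpa) (by simpa)

theorem div_lt_one_of_add_le {x δ p : ℝ≥0∞} (hδ : δ ≠ 0) (hp : p ≠ ⊤) (h : x + δ ≤ p) :
    x / p < 1 := by
  have hx : x ≠ ⊤ := ne_top_of_le_ne_top hp (le_self_add.trans h)
  refine ENNReal.div_lt_of_lt_mul ?_
  rw [one_mul]
  exact (ENNReal.lt_add_right hx hδ).trans_le h

variable {d : ℕ} {μ : Measure (Fin d)} [IsProbabilityMeasure μ] (k : Fin d) {p δ : ℝ≥0∞}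

theorem foldlMean_lisStep_le (hδ : δ ≠ 0) (hp : p ≠ ⊤) (hμ : ∀ i, k ≤ i → μ {i} + δ ≤ p) (n : ℕ) :
    foldlMean μ (lisStep k) d n 0 ≤ p * n + ∑ i ∈ Finset.Ici k, μ {i} / δ := by
  set r : Fin d → ℝ≥0∞ := fun i => if k ≤ i then μ {i} / p else 0
  have hp₀ : p ≠ 0 := ne_bot_of_le_ne_bot hδ (le_add_self.trans (hμ k le_rfl))
  have hr (i : Fin d) : r i < 1 := by
    by_cases hi : k ≤ i
    · simpa only [r, hi, if_true] using div_lt_one_of_add_le hδ hp (hμ i hi)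
    · simp [r, hi]
  have hsum : ∑ i, r i / (1 - r i) ≤ ∑ i ∈ Finset.Ici k, μ {i} / δ := by
    rw [← Finset.filter_le_eq_Ici, Finset.sum_filter]
    refine Finset.sum_le_sum fun i _ => ?_
    by_cases hi : k ≤ i
    · simpa only [r, hi, if_true] using div_div_one_sub_le hδ hp (hμ i hi)
    · simp [r, hi]
  calc foldlMean μ (lisStep k) d n 0 ≤ rowMean μ k r n := foldlMean_le_rowMean hr
    _ ≤ p * n + ∑ i, r i / (1 - r i) := by
      refine rowMean_le hr hp (fun i hi => if_neg (by simpa using hi)) (fun i hi => ?_) n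
      rw [show r i = μ {i} / p from if_pos hi, ENNReal.mul_div_cancel hp₀ hp]
    _ ≤ _ := by gcongr

theorem le_foldlMean_tandemStep (hδ : δ ≠ 0) (hk : p ≤ μ {k}) (hμ : ∀ i < k, p + δ ≤ μ {i})
    (n : ℕ) : p * n ≤ foldlMean μ (tandemStep k) 0 n 0 + k * (p / δ) := by
  rcases eq_or_ne p 0 with rfl | hp₀
  · simp
  have hp : p ≠ ⊤ := ne_top_of_le_ne_top (measure_ne_top μ _) hk
  set α : Fin k → ℝ≥0∞ := fun i => μ {i.castLE k.isLt.le}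
  have hα (i : Fin k) : p + δ ≤ α i := hμ _ (Fin.lt_def.mpr i.isLt)
  have hα₀ (i : Fin k) : α i ≠ 0 := ne_bot_of_le_ne_bot hp₀ (le_self_add.trans (hα i))
  have hα_top (i : Fin k) : α i ≠ ⊤ := measure_ne_top μ _
  have hr (i : Fin k) : p / α i < 1 := div_lt_one_of_add_le hδ (hα_top i) (hα i)
  calc p * n ≤ queueMean μ k (fun i => p / α i) n :=
        mul_le_queueMean (s := fun i => α i / p) hr
          (fun i => by
            rw [← mul_div_assoc, ENNReal.div_mul_cancel hp₀ hp,
              ENNReal.div_self (hα₀ i) (hα_top i)])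
          (fun i => (ENNReal.mul_div_cancel hp₀ hp).symm) hk n
    _ ≤ foldlMean μ (tandemStep k) 0 n 0 + ∑ i, p / α i / (1 - p / α i) := queueMean_le hr n
    _ ≤ foldlMean μ (tandemStep k) 0 n 0 + ∑ _i : Fin k, p / δ := by
      gcongr foldlMean μ _ 0 n 0 + ∑ i, ?_ with i
      exact div_div_one_sub_le hδ (hα_top i) (hα i)
    _ = _ := by simp

end Drift

section WordLaw

variable {d : ℕ} {α : Fin d → ℝ}

theorem letterLaw_singleton (α : Fin d → ℝ) (i : Fin d) :
    letterLaw α {i} = ENNReal.ofReal (α i) := by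
  simp [letterLaw, Measure.finsetSum_apply, Set.indicator_apply]

theorem isProbabilityMeasure_letterLaw (hα : α ∈ stdSimplex ℝ (Fin d)) :
    IsProbabilityMeasure (letterLaw α) := by
  constructor
  rw [← Finset.coe_univ, ← sum_measure_singleton]
  simp only [letterLaw_singleton]
  rw [← ENNReal.ofReal_sum_of_nonneg fun i _ => hα.1 i, hα.2, ENNReal.ofReal_one]

theorem isProbabilityMeasure_wordLaw (hα : α ∈ stdSimplex ℝ (Fin d)) (n : ℕ) :
    IsProbabilityMeasure (wordLaw n α) :=
  have := isProbabilityMeasure_letterLaw hα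
  inferInstanceAs (IsProbabilityMeasure (Measure.pi fun _ => letterLaw α))

theorem integral_schurWeyl (n : ℕ) (α : Fin d → ℝ) (k : Fin d) :
    ∫ l, (l k : ℝ) ∂schurWeyl n α = ∫ w, (shape w k : ℝ) ∂wordLaw n α :=
  integral_map (measurable_of_countable _).aemeasurable
    (measurable_of_countable _).aestronglyMeasurable

theorem ofReal_integral_natCast (hα : α ∈ stdSimplex ℝ (Fin d)) {n : ℕ}
    (F : (Fin n → Fin d) → ℕ) :
    ENNReal.ofReal (∫ w, (F w : ℝ) ∂wordLaw n α) = ∫⁻ w, (F w : ℝ≥0∞) ∂wordLaw n α := by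
  have := isProbabilityMeasure_wordLaw hα n
  rw [ofReal_integral_eq_lintegral_ofReal .of_finite (ae_of_all _ fun _ => by positivity)]
  simp only [ENNReal.ofReal_natCast]

theorem integral_wordLaw_mono (hα : α ∈ stdSimplex ℝ (Fin d)) {n : ℕ}
    {F F' : (Fin n → Fin d) → ℕ} (h : ∀ w, F w ≤ F' w) :
    ∫ w, (F w : ℝ) ∂wordLaw n α ≤ ∫ w, (F' w : ℝ) ∂wordLaw n α := by
  have := isProbabilityMeasure_wordLaw hα n
  exact integral_mono .of_finite .of_finite fun w => Nat.mono_cast (h w)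

variable {k : Fin d} {n : ℕ} {a b δ : ℝ}

theorem integral_lisFrom_le_add (hα : α ∈ stdSimplex ℝ (Fin d)) (hb : ∀ i, k ≤ i → α i ≤ b)
    (hδ : 0 < δ) :
    ∫ w, (lisFrom k (List.ofFn w) : ℝ) ∂wordLaw n α ≤
      (b + δ) * n + ∑ i ∈ Finset.Ici k, α i / δ := by
  have := isProbabilityMeasure_letterLaw hα
  have hb₀ : 0 ≤ b := (hα.1 k).trans (hb k le_rfl)
  have hdiv (i : Fin d) : 0 ≤ α i / δ := div_nonneg (hα.1 i) hδ.le
  have hsum : 0 ≤ ∑ i ∈ Finset.Ici k, α i / δ := Finset.sum_nonneg fun i _ => hdiv i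
  have h := foldlMean_lisStep_le (μ := letterLaw α) (δ := ENNReal.ofReal δ)
    (p := ENNReal.ofReal (b + δ)) k (by simpa) ENNReal.ofReal_ne_top (fun i hi => by
      rw [letterLaw_singleton, ← ENNReal.ofReal_add (hα.1 i) hδ.le]
      exact ENNReal.ofReal_le_ofReal (by linarith [hb i hi])) n
  simp only [letterLaw_singleton, ← ENNReal.ofReal_div_of_pos hδ] at h
  rw [← ENNReal.ofReal_le_ofReal_iff (by positivity),
    ofReal_integral_natCast hα fun w => lisFrom k (List.ofFn w),
    ENNReal.ofReal_add (by positivity) hsum, ENNReal.ofReal_mul (by positivity),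
    ENNReal.ofReal_natCast, ENNReal.ofReal_sum_of_nonneg fun i _ => hdiv i]
  exact h

theorem le_integral_throughput_add (hα : α ∈ stdSimplex ℝ (Fin d)) (ha : ∀ i ≤ k, a ≤ α i)
    (hδ : 0 < δ) (hδa : δ ≤ a) :
    (a - δ) * n ≤ ∫ w, (throughput k (List.ofFn w) : ℝ) ∂wordLaw n α + k * ((a - δ) / δ) := by
  have := isProbabilityMeasure_letterLaw hα
  have hp : 0 ≤ a - δ := sub_nonneg.mpr hδa
  have h := le_foldlMean_tandemStep (μ := letterLaw α) (δ := ENNReal.ofReal δ)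
    (p := ENNReal.ofReal (a - δ)) k (by simpa)
    (by
      rw [letterLaw_singleton]
      exact ENNReal.ofReal_le_ofReal (by linarith [ha k le_rfl]))
    (fun i hi => by
      rw [letterLaw_singleton, ← ENNReal.ofReal_add hp hδ.le, sub_add_cancel]
      exact ENNReal.ofReal_le_ofReal (ha i hi.le)) n
  rw [← ENNReal.ofReal_le_ofReal_iff (by positivity), ENNReal.ofReal_mul hp,
    ENNReal.ofReal_add (by positivity) (by positivity), ENNReal.ofReal_mul (by positivity),
    ofReal_integral_natCast hα fun w => throughput k (List.ofFn w),
    ENNReal.ofReal_div_of_pos hδ, ENNReal.ofReal_natCast, ENNReal.ofReal_natCast]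
  exact h

/-- The quadratic in `δ` has no positive discriminant, which covers `β = 0` and `x = 0` as well,
where the infimum over `δ` is not attained. -/
theorem le_two_mul_sqrt {c β x : ℝ} (hx : 0 ≤ x) (hβ : 0 ≤ β)
    (h : ∀ δ > 0, c ≤ δ * x + β / δ) : c ≤ 2 * √(β * x) := by
  rcases le_or_gt c 0 with hc | hc
  · exact hc.trans (by positivity)
  have hquad (δ : ℝ) : 0 ≤ x * (δ * δ) + -c * δ + β := by
    rcases le_or_gt δ 0 with hδ | hδ
    · nlinarith [mul_nonneg hx (mul_self_nonneg δ)]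
    · have hmul := mul_le_mul_of_nonneg_right (h δ hδ) hδ.le
      rw [add_mul, div_mul_cancel₀ _ hδ.ne'] at hmul
      linarith
  have hdiscrim : c ^ 2 ≤ 2 ^ 2 * (β * x) := by
    have := discrim_le_zero hquad
    rw [discrim] at this
    linarith
  calc c = √(c ^ 2) := (Real.sqrt_sq hc.le).symm
    _ ≤ √(2 ^ 2 * (β * x)) := Real.sqrt_le_sqrt hdiscrim
    _ = 2 * √(β * x) := by rw [Real.sqrt_mul (by positivity), Real.sqrt_sq (by norm_num)]

theorem integral_lisFrom_le (hα : α ∈ stdSimplex ℝ (Fin d)) (hb : ∀ i, k ≤ i → α i ≤ b) :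
    ∫ w, (lisFrom k (List.ofFn w) : ℝ) ∂wordLaw n α ≤
      b * n + 2 * √((∑ i ∈ Finset.Ici k, α i) * n) := by
  rw [← sub_le_iff_le_add']
  refine le_two_mul_sqrt n.cast_nonneg (Finset.sum_nonneg fun i _ => hα.1 i) fun δ hδ => ?_
  have := integral_lisFrom_le_add (n := n) hα hb hδ
  rw [Finset.sum_div]
  linarith

theorem le_integral_throughput (hα : α ∈ stdSimplex ℝ (Fin d)) (ha₀ : 0 ≤ a)
    (ha : ∀ i ≤ k, a ≤ α i) :
    a * n - 2 * √(a * ((k : ℕ) + 1 : ℝ) * n) ≤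
      ∫ w, (throughput k (List.ofFn w) : ℝ) ∂wordLaw n α := by
  rw [sub_le_comm]
  refine le_two_mul_sqrt n.cast_nonneg (by positivity) fun δ hδ => ?_
  have hE : 0 ≤ ∫ w, (throughput k (List.ofFn w) : ℝ) ∂wordLaw n α := by positivity
  rcases le_total δ a with hδa | hδa
  · have h := le_integral_throughput_add (n := n) hα ha hδ hδa
    have hk : k * ((a - δ) / δ) ≤ a * ((k : ℕ) + 1 : ℝ) / δ := by
      rw [← mul_div_assoc]
      exact div_le_div_of_nonneg_right
        (by nlinarith [mul_nonneg (Nat.cast_nonneg (α := ℝ) k) hδ.le]) hδ.le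
    linarith
  · have : a * n ≤ δ * n := by gcongr
    have : 0 ≤ a * ((k : ℕ) + 1 : ℝ) / δ := by positivity
    linarith

theorem sum_Ici_le_min (hα : α ∈ stdSimplex ℝ (Fin d)) (hb : ∀ i, k ≤ i → α i ≤ b) :
    ∑ i ∈ Finset.Ici k, α i ≤ min 1 (b * d) := by
  have hb₀ : 0 ≤ b := (hα.1 k).trans (hb k le_rfl)
  refine le_min ((Finset.sum_le_univ_sum_of_nonneg hα.1).trans_eq hα.2) ?_
  calc ∑ i ∈ Finset.Ici k, α i ≤ ∑ _i ∈ Finset.Ici k, b :=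
        Finset.sum_le_sum fun i hi => hb i (Finset.mem_Ici.mp hi)
    _ ≤ ∑ _i : Fin d, b := Finset.sum_le_univ_sum_of_nonneg fun _ => hb₀
    _ = b * d := by simp [mul_comm]

theorem mul_add_one_le_min (hα : α ∈ stdSimplex ℝ (Fin d)) (ha₀ : 0 ≤ a)
    (ha : ∀ i ≤ k, a ≤ α i) : a * ((k : ℕ) + 1 : ℝ) ≤ min 1 (a * d) := by
  refine le_min ?_ (mul_le_mul_of_nonneg_left (by exact_mod_cast k.isLt) ha₀)
  calc a * ((k : ℕ) + 1 : ℝ) = ∑ _i ∈ Finset.Iic k, a := by simp [mul_comm]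
    _ ≤ ∑ i ∈ Finset.Iic k, α i := Finset.sum_le_sum fun i hi => ha i (Finset.mem_Iic.mp hi)
    _ ≤ 1 := (Finset.sum_le_univ_sum_of_nonneg hα.1).trans_eq hα.2

end WordLaw

section Permutation

theorem lis_le_lisFrom {n d : ℕ} (π : Equiv.Perm (Fin n)) {v : Fin n → Fin d} (hv : Monotone v) :
    lis π ≤ lisFrom 0 (List.ofFn (v ∘ π)) := by
  classical
  refine Finset.sup_le fun s hs => ?_
  have hs : MonotoneOn π s := by
    simpa only [Finset.mem_filter, Finset.mem_univ, true_and] using hs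
  have hsub : (((List.finRange n).filter (· ∈ s)).map (v ∘ π)).Sublist (List.ofFn (v ∘ π)) := by
    rw [List.ofFn_eq_map]
    exact List.filter_sublist.map _
  have hincr : (((List.finRange n).filter (· ∈ s)).map (v ∘ π)).Pairwise (· ≤ ·) := by
    rw [List.pairwise_map]
    refine ((List.pairwise_lt_finRange n).filter _).imp_of_mem fun {i j} hi hj hij => ?_
    exact hv (hs (by simpa using hi) (by simpa using hj) hij.le)
  have hcard : ((List.finRange n).filter (· ∈ s)).length = s.card := by
    rw [← List.toFinset_card_of_nodup ((List.nodup_finRange n).filter _)]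
    congr 1
    ext
    simp
  rw [← hcard, ← List.length_map (v ∘ π)]
  exact length_le_lisFrom 0 hsub hincr fun _ _ => Nat.zero_le _

theorem sum_lis_le_sum_lisFrom {n d : ℕ} (w : Fin n → Fin d) :
    ∑ π : Equiv.Perm (Fin n), lis π ≤ ∑ π : Equiv.Perm (Fin n), lisFrom 0 (List.ofFn (w ∘ π)) :=
  (Finset.sum_le_sum fun π _ => lis_le_lisFrom π (Tuple.monotone_sort w)).trans_eq
    (Equiv.sum_comp (Equiv.mulLeft (Tuple.sort w)) fun π : Equiv.Perm (Fin n) =>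
      lisFrom 0 (List.ofFn (w ∘ π)))

theorem integral_wordLaw_comp_perm {n d : ℕ} {α : Fin d → ℝ} (hα : α ∈ stdSimplex ℝ (Fin d))
    (π : Equiv.Perm (Fin n)) (F : (Fin n → Fin d) → ℝ) :
    ∫ w, F (w ∘ π) ∂wordLaw n α = ∫ w, F w ∂wordLaw n α := by
  have := isProbabilityMeasure_letterLaw hα
  have hperm := measurePreserving_arrowCongr' (fun _ => letterLaw α) (fun _ => letterLaw α)
    π.symm (.refl (Fin d)) fun _ => MeasurePreserving.id _
  exact hperm.integral_comp' F

theorem expectedLisPerm_le_integral {d : ℕ} {α : Fin d → ℝ} (hα : α ∈ stdSimplex ℝ (Fin d))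
    (n : ℕ) : expectedLisPerm n ≤ ∫ w, (lisFrom 0 (List.ofFn w) : ℝ) ∂wordLaw n α := by
  have := isProbabilityMeasure_wordLaw hα n
  rw [expectedLisPerm, div_le_iff₀ (by positivity)]
  calc ∑ π : Equiv.Perm (Fin n), (lis π : ℝ)
      = ∫ _w, ∑ π : Equiv.Perm (Fin n), (lis π : ℝ) ∂wordLaw n α := by simp
    _ ≤ ∫ w, ∑ π : Equiv.Perm (Fin n), (lisFrom 0 (List.ofFn (w ∘ π)) : ℝ) ∂wordLaw n α :=
      integral_mono .of_finite .of_finite fun w => by exact_mod_cast sum_lis_le_sum_lisFrom w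
    _ = ∑ π : Equiv.Perm (Fin n), ∫ w, (lisFrom 0 (List.ofFn (w ∘ π)) : ℝ) ∂wordLaw n α :=
      integral_finsetSum _ fun _ _ => .of_finite
    _ = (∫ w, (lisFrom 0 (List.ofFn w) : ℝ) ∂wordLaw n α) * n.factorial := by
      simp only [integral_wordLaw_comp_perm hα _ fun w => (lisFrom 0 (List.ofFn w) : ℝ),
        Finset.sum_const, Finset.card_univ, Fintype.card_perm, Fintype.card_fin, nsmul_eq_mul,
        mul_comm]

theorem expectedLisPerm_le_add (n d : ℕ) :
    expectedLisPerm n ≤ 1 / ((d : ℝ) + 1) * n + 2 * √n := by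
  set α : Fin (d + 1) → ℝ := fun _ => 1 / ((d : ℝ) + 1)
  have hα : α ∈ stdSimplex ℝ (Fin (d + 1)) :=
    ⟨fun _ => by positivity, by simp [α, Nat.cast_add_one_ne_zero]⟩
  have h := integral_lisFrom_le (n := n) (k := 0) (b := 1 / ((d : ℝ) + 1)) hα fun _ _ => le_rfl
  have hIci : Finset.Ici (0 : Fin (d + 1)) = Finset.univ := by
    ext
    simp
  rw [hIci, hα.2, one_mul] at h
  exact (expectedLisPerm_le_integral hα n).trans h

theorem expectedLisPerm_le (n : ℕ) : expectedLisPerm n ≤ 2 * √(n : ℝ) := by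
  have h : Filter.Tendsto (fun d : ℕ => 1 / ((d : ℝ) + 1) * n + 2 * √n) Filter.atTop
      (nhds (0 * n + 2 * √n)) :=
    (tendsto_one_div_add_atTop_nhds_zero_nat.mul_const _).add_const _
  simpa only [zero_mul, zero_add] using ge_of_tendsto' h (expectedLisPerm_le_add n)

end Permutation

end RSK

theorem theorem1_general (n : ℕ) :
    (∀ (d : ℕ) (α : Fin d → ℝ), α ∈ stdSimplex ℝ (Fin d) → ∀ (k : Fin d) (a b : ℝ), 0 ≤ a →
      (∀ i ≤ k, a ≤ α i) → (∀ i, k ≤ i → α i ≤ b) →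
      (a * n - 2 * √(min 1 (a * d) * n) ≤ ∫ l, (l k : ℝ) ∂(schurWeyl n α) ∧
        ∫ l, (l k : ℝ) ∂(schurWeyl n α) ≤ b * n + 2 * √(min 1 (b * d) * n)) ∧
      (a * n - 2 * √(a * ((k : ℕ) + 1 : ℝ) * n) ≤ ∫ l, (l k : ℝ) ∂(schurWeyl n α) ∧
        ∫ l, (l k : ℝ) ∂(schurWeyl n α) ≤ b * n + 2 * √((∑ i ∈ Finset.Ici k, α i) * n))) ∧
    expectedLisPerm n ≤ 2 * √(n : ℝ) := by
  refine ⟨fun d α hα k a b ha₀ ha hb => ?_, RSK.expectedLisPerm_le n⟩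
  rw [RSK.integral_schurWeyl]
  have hlow := (RSK.le_integral_throughput (n := n) hα ha₀ ha).trans
    (RSK.integral_wordLaw_mono hα fun w => RSK.throughput_le_shape w k)
  have hupp := (RSK.integral_wordLaw_mono hα fun w => RSK.shape_le_lisFrom w k).trans
    (RSK.integral_lisFrom_le (n := n) hα hb)
  refine ⟨⟨le_trans ?_ hlow, hupp.trans ?_⟩, hlow, hupp⟩
  · gcongr
    exact RSK.mul_add_one_le_min hα ha₀ ha
  · gcongr
    exact RSK.sum_Ici_le_min hα hb

theorem theorem1 (n : ℕ) :
    (∀ (d : ℕ) (α : Fin d → ℝ), α ∈ stdSimplex ℝ (Fin d) → Antitone α → ∀ k : Fin d,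
      (α k * n - 2 * √(min 1 (α k * d) * n) ≤ ∫ l, (l k : ℝ) ∂(schurWeyl n α) ∧
        ∫ l, (l k : ℝ) ∂(schurWeyl n α) ≤ α k * n + 2 * √(min 1 (α k * d) * n)) ∧
      (α k * n - 2 * √(α k * ((k : ℕ) + 1 : ℝ) * n) ≤ ∫ l, (l k : ℝ) ∂(schurWeyl n α) ∧
        ∫ l, (l k : ℝ) ∂(schurWeyl n α) ≤ α k * n + 2 * √((∑ i ∈ Finset.Ici k, α i) * n))) ∧
    expectedLisPerm n ≤ 2 * √(n : ℝ) := by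
  refine ⟨fun d α hα hanti k => ?_, (theorem1_general n).2⟩
  exact (theorem1_general n).1 d α hα k (α k) (α k) (hα.1 k) (fun _ h => hanti h) fun _ h => hanti h
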